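/- A path decomposition of a directed graph $G$ (without loops or multiple arcs) is a family of simple directed paths, each with at least one edge, such that every edge of $G$ lies on exactly one of them. A walk decomposition of $G$ is a family of directed walks in $G$ (vertices and edges may be repeated, and different walks may share edges) such that every edge of $G$ lies on at least one of them. The computation model is the deterministic random access machine with a read-only, randomly accessible input and read-write registers, where each assignment, addition, subtraction, comparison, jump, (indirect) register access or access to an input word counts as one step; space is the total number of bits held in the registers, counting at least one bit for every register up to the last nonzero one. A decomposition of a graph with vertex set $\{0,\dots,n-1\}$ into $k\ge 1$ paths or walks, together with two vertices $s,t$, is given as the sequence of the numbers $n,k,s,t$, followed, for each path or walk, by its number of vertices and its vertices in order. Theorem. There is one deterministic algorithm (a single program of this model) which does the following. (1) Given a path decomposition of a directed graph $G$ on $n$ vertices into $k\ge 1$ directed paths and two vertices $s,t$ of $G$, it decides whether $t$ is reachable from $s$ in $G$, using $O(k\log n)$ bits of space and $O(n^3k^2)$ steps, with all registers of $O(\log n)$ bits at all times. (As $k\le n(n-1)$, this is polynomial time.) (2) Given, more generally, a walk decomposition of $G$ into $k\ge 1$ directed walks, which need not be edge-disjoint, and two vertices $s,t$ of $G$, it decides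 whether $t$ is reachable from $s$ in $G$, using $O(k\log (n+\ell))$ bits of space and $O(n\,\ell^2k^2)$ steps, with all registers of $O(\log (n+k+\ell))$ bits, where every walk has at most $\ell$ vertices. In particular the space is $O(k\log n)$ if $n \ge 2$ and $\ell$ is bounded by a fixed polynomial in $n$. The constants in the bounds are absolute. -/

import Mathlib

/-! Directed graphs, walk decompositions and path decompositions -/

/-- `l` lists the vertices of a directed walk of `G`, in order (possibly a single vertex). -/
def IsDiwalk {n : ℕ} (G : Digraph (Fin n)) (l : List (Fin n)) : Prop :=
  l ≠ [] ∧ l.IsChain G.Adj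

/-- The arc `(u, v)` is traversed by the walk `l`. -/
def LiesOn {n : ℕ} (u v : Fin n) (l : List (Fin n)) : Prop :=
  [u, v] <:+: l

/-- A family of `k` directed walks of `G` whose union contains every edge of `G`.
The walks may share edges and may repeat vertices and edges. -/
structure IsWalkDecomposition {n k : ℕ} (G : Digraph (Fin n))
    (P : Fin k → List (Fin n)) : Prop where
  walk : ∀ i, IsDiwalk G (P i)
  cover : ∀ u v, G.Adj u v → ∃ i, LiesOn u v (P i)

/-- A partition of the edges of `G` into `k` simple directed paths: each path has at least one
edge and no repeated vertex, and every edge of `G` lies on exactly one of the paths.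
(Such a `G` has no loops.) -/
structure IsPathDecomposition {n k : ℕ} (G : Digraph (Fin n))
    (P : Fin k → List (Fin n)) : Prop where
  walk : ∀ i, IsDiwalk G (P i)
  simple : ∀ i, (P i).Nodup
  has_edge : ∀ i, 2 ≤ (P i).length
  partition : ∀ u v, G.Adj u v → ∃! i, LiesOn u v (P i)

/-- There is a directed path (possibly of length `0`) from `s` to `t` in `G`. -/
def DiReachable {n : ℕ} (G : Digraph (Fin n)) (s t : Fin n) : Prop :=
  Relation.ReflTransGen G.Adj s t

/-- The input word sequence: `n, k, s, t`, followed, for each of the `k` walks in turn, by its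
number of vertices and then its vertices in order. -/
def encodeInstance {n k : ℕ} (P : Fin k → List (Fin n)) (s t : Fin n) : List ℕ :=
  [n, k, (s : ℕ), (t : ℕ)] ++
    (List.ofFn fun i => (P i).length :: (P i).map Fin.val).flatten

/-! Random access machines with a read-only input and a read-write memory of registers.
Arguments named `r`, `a`, `b` are register addresses, `l` is a line of the program. -/

namespace RAM

/-- The instruction set. -/
inductive Instr where
  /-- `R[r] := c` -/
  | const (r c : ℕ)
  /-- `R[r] := R[a]` -/
  | copy (r a : ℕ)
  /-- `R[r] := R[a] + R[b]` -/
  | add (r a b : ℕ)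
  /-- `R[r] := max (R[a] - R[b]) 0` -/
  | sub (r a b : ℕ)
  /-- `R[r] := R[R[a]]` -/
  | load (r a : ℕ)
  /-- `R[R[a]] := R[b]` -/
  | store (a b : ℕ)
  /-- `R[r] :=` the input word at position `R[a]` (and `0` beyond the end of the input) -/
  | read (r a : ℕ)
  /-- go to line `l` -/
  | jump (l : ℕ)
  /-- go to line `l` if `R[a] = R[b]` -/
  | jeq (a b l : ℕ)
  /-- go to line `l` if `R[a] < R[b]` -/
  | jlt (a b l : ℕ)
  /-- halt and accept (`true`) or reject (`false`) -/
  | halt (accept : Bool)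

/-- A program is a finite list of instructions; its lines are numbered from `0`. -/
abbrev Program := List Instr

/-- A configuration: the current line and the contents of the registers. -/
structure Config where
  line : ℕ
  mem : ℕ → ℕ

/-- Write `x` into register `r` and proceed to the next line. -/
def Config.write (c : Config) (r x : ℕ) : Config :=
  ⟨c.line + 1, Function.update c.mem r x⟩

/-- Go to line `l` if `q` holds, and to the next line otherwise. -/
def Config.branch (c : Config) (q : Prop) [Decidable q] (l : ℕ) : Config :=
  ⟨if q then l else c.line + 1, c.mem⟩

/-- The effect of one instruction. -/
def Instr.exec (input : List ℕ) (c : Config) : Instr → Config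
  | .const r x => c.write r x
  | .copy r a => c.write r (c.mem a)
  | .add r a b => c.write r (c.mem a + c.mem b)
  | .sub r a b => c.write r (c.mem a - c.mem b)
  | .load r a => c.write r (c.mem (c.mem a))
  | .store a b => c.write (c.mem a) (c.mem b)
  | .read r a => c.write r (input.getD (c.mem a) 0)
  | .jump l => ⟨l, c.mem⟩
  | .jeq a b l => c.branch (c.mem a = c.mem b) l
  | .jlt a b l => c.branch (c.mem a < c.mem b) l
  | .halt _ => c

/-- One step of the machine (nothing happens outside the program). -/
def step (p : Program) (input : List ℕ) (c : Config) : Config :=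
  match p[c.line]? with
  | some i => i.exec input c
  | none => c

/-- The configuration after `τ` steps from line `0` with all registers `0`. -/
def configAt (p : Program) (input : List ℕ) (τ : ℕ) : Config :=
  (step p input)^[τ] ⟨0, fun _ => 0⟩

/-- Within `T` steps the program halts, with verdict `b`. -/
def HaltsWithin (p : Program) (input : List ℕ) (T : ℕ) (b : Bool) : Prop :=
  ∃ τ ≤ T, p[(configAt p input τ).line]? = some (Instr.halt b)

/-- The memory contents `m` fit into `S` bits: from some address `M` on all registers are `0`,
and the registers `0, …, M - 1` have binary lengths adding up to at most `S`, where every one of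
them, even if it contains `0`, is charged at least one bit. -/
def FitsInBits (m : ℕ → ℕ) (S : ℕ) : Prop :=
  ∃ M, (∀ a, M ≤ a → m a = 0) ∧ ∑ a ∈ Finset.range M, max 1 (Nat.size (m a)) ≤ S

/-- On this input the program decides the proposition `A` within `T` steps, using at every moment
at most `S` bits of memory in registers of at most `w` bits each. -/
def Decides (p : Program) (input : List ℕ) (A : Prop) (T S w : ℕ) : Prop :=
  (∃ b : Bool, HaltsWithin p input T b ∧ (b = true ↔ A)) ∧
  (∀ τ, FitsInBits (configAt p input τ).mem S) ∧
  (∀ τ r, Nat.size ((configAt p input τ).mem r) ≤ w)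

end RAM

/-! Once one vertex of a directed walk is reachable, so are all later ones. Hence what is known
about a walk is one number, the length of its suffix known to be reachable, and `k` numbers of size
at most `ℓ` are the whole state of a search. This replaces the usual bit per vertex and gives the
space bound.

The search proceeds in rounds. A round visits every vertex occurrence on every walk; if the vertex
is `s` or the occurrence lies in the marked suffix, all marked suffixes are extended to contain
every occurrence of that vertex. Marks stay correct by the remark above (`Sound.mark`). A round
advances by at least one breadth-first level (`reached_succ`): if the arc from `u` to `v` lies on a
walk and `u` was reached before the round, that occurrence of `u` becomes marked, and with it the
next vertex `v`. Levels grow strictly until `t` appears, so a reachable `t` is in level `n - 1`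
(`mem_level_of_diReachable`), and `n` rounds test levels `0, …, n - 1` (`runs_rounds`). Each of at
most `k * ℓ` occurrences per round triggers at most one scan of cost `O(k * ℓ)`.

Only the covering of the edges is used for correctness. For path decompositions, simplicity gives `ℓ
≤ n` and disjointness gives `k ≤ n * n`. -/

/-! ### Symbolic execution of programs -/

namespace RAM

/-- From configuration `c` the program halts within `T` steps with the verdict on `A`, and the
memory satisfies `Q` all the way. -/
inductive RunsTo (p : Program) (input : List ℕ) (Q : (ℕ → ℕ) → Prop) (A : Prop) :
    ℕ → Config → Prop
  | halt {T l m} (b : Bool) (hp : p[l]? = some (.halt b)) (hb : b = true ↔ A) (hQ : Q m) :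
      RunsTo p input Q A T ⟨l, m⟩
  | step {T l m} (hQ : Q m) (h : RunsTo p input Q A T (RAM.step p input ⟨l, m⟩)) :
      RunsTo p input Q A (T + 1) ⟨l, m⟩

namespace RunsTo

variable {p : Program} {input : List ℕ} {Q : (ℕ → ℕ) → Prop} {A : Prop} {T T' l : ℕ} {m : ℕ → ℕ}

theorem mono {c : Config} (h : RunsTo p input Q A T c) (hT : T ≤ T') :
    RunsTo p input Q A T' c := by
  induction h generalizing T' with
  | halt b hp hb hQ => exact .halt b hp hb hQ
  | step hQ _ ih =>
    obtain ⟨T', rfl⟩ := Nat.exists_eq_add_of_le' (show 1 ≤ T' by omega)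
    exact .step hQ (ih (by omega))

theorem const {r x : ℕ} (hp : p[l]? = some (.const r x)) (hQ : Q m)
    (h : RunsTo p input Q A T ⟨l + 1, Function.update m r x⟩) :
    RunsTo p input Q A (T + 1) ⟨l, m⟩ :=
  .step hQ (by simpa [RAM.step, hp, Instr.exec, Config.write] using h)

theorem copy {r a : ℕ} (hp : p[l]? = some (.copy r a)) (hQ : Q m)
    (h : RunsTo p input Q A T ⟨l + 1, Function.update m r (m a)⟩) :
    RunsTo p input Q A (T + 1) ⟨l, m⟩ :=
  .step hQ (by simpa [RAM.step, hp, Instr.exec, Config.write] using h)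

theorem add {r a b : ℕ} (hp : p[l]? = some (.add r a b)) (hQ : Q m)
    (h : RunsTo p input Q A T ⟨l + 1, Function.update m r (m a + m b)⟩) :
    RunsTo p input Q A (T + 1) ⟨l, m⟩ :=
  .step hQ (by simpa [RAM.step, hp, Instr.exec, Config.write] using h)

theorem sub {r a b : ℕ} (hp : p[l]? = some (.sub r a b)) (hQ : Q m)
    (h : RunsTo p input Q A T ⟨l + 1, Function.update m r (m a - m b)⟩) :
    RunsTo p input Q A (T + 1) ⟨l, m⟩ :=
  .step hQ (by simpa [RAM.step, hp, Instr.exec, Config.write] using h)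

theorem load {r a : ℕ} (hp : p[l]? = some (.load r a)) (hQ : Q m)
    (h : RunsTo p input Q A T ⟨l + 1, Function.update m r (m (m a))⟩) :
    RunsTo p input Q A (T + 1) ⟨l, m⟩ :=
  .step hQ (by simpa [RAM.step, hp, Instr.exec, Config.write] using h)

theorem store {a b : ℕ} (hp : p[l]? = some (.store a b)) (hQ : Q m)
    (h : RunsTo p input Q A T ⟨l + 1, Function.update m (m a) (m b)⟩) :
    RunsTo p input Q A (T + 1) ⟨l, m⟩ :=
  .step hQ (by simpa [RAM.step, hp, Instr.exec, Config.write] using h)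

theorem read {r a : ℕ} (hp : p[l]? = some (.read r a)) (hQ : Q m)
    (h : RunsTo p input Q A T ⟨l + 1, Function.update m r (input.getD (m a) 0)⟩) :
    RunsTo p input Q A (T + 1) ⟨l, m⟩ :=
  .step hQ (by simpa [RAM.step, hp, Instr.exec, Config.write] using h)

theorem jump {l' : ℕ} (hp : p[l]? = some (.jump l')) (hQ : Q m)
    (h : RunsTo p input Q A T ⟨l', m⟩) :
    RunsTo p input Q A (T + 1) ⟨l, m⟩ :=
  .step hQ (by simpa [RAM.step, hp, Instr.exec] using h)

theorem jeq {a b l' : ℕ} (hp : p[l]? = some (.jeq a b l')) (hQ : Q m)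
    (h : m a = m b → RunsTo p input Q A T ⟨l', m⟩)
    (h' : m a ≠ m b → RunsTo p input Q A T ⟨l + 1, m⟩) :
    RunsTo p input Q A (T + 1) ⟨l, m⟩ := by
  refine .step hQ ?_
  by_cases hab : m a = m b
  · simpa [RAM.step, hp, Instr.exec, Config.branch, hab] using h hab
  · simpa [RAM.step, hp, Instr.exec, Config.branch, hab] using h' hab

theorem jlt {a b l' : ℕ} (hp : p[l]? = some (.jlt a b l')) (hQ : Q m)
    (h : m a < m b → RunsTo p input Q A T ⟨l', m⟩)
    (h' : ¬ m a < m b → RunsTo p input Q A T ⟨l + 1, m⟩) :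
    RunsTo p input Q A (T + 1) ⟨l, m⟩ := by
  refine .step hQ ?_
  by_cases hab : m a < m b
  · simpa [RAM.step, hp, Instr.exec, Config.branch, hab] using h hab
  · simpa [RAM.step, hp, Instr.exec, Config.branch, hab] using h' hab

/-- A halting configuration is a fixed point of `step`, so the invariant holds at all times, not
only up to the halt. -/
theorem exists_halt {c : Config} (h : RunsTo p input Q A T c) :
    (∃ b : Bool, (∃ τ ≤ T, p[((RAM.step p input)^[τ] c).line]? = some (.halt b)) ∧
      (b = true ↔ A)) ∧ ∀ τ, Q ((RAM.step p input)^[τ] c).mem := by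
  induction h with
  | @halt T l m b hp hb hQ =>
    refine ⟨⟨b, ⟨0, Nat.zero_le _, hp⟩, hb⟩, fun τ => ?_⟩
    have hfix : RAM.step p input ⟨l, m⟩ = ⟨l, m⟩ := by simp [RAM.step, hp, Instr.exec]
    rwa [Function.iterate_fixed hfix]
  | @step T l m hQ _ ih =>
    obtain ⟨⟨b, ⟨τ, hτ, hp⟩, hb⟩, hall⟩ := ih
    refine ⟨⟨b, ⟨τ + 1, by omega, hp⟩, hb⟩, fun τ => ?_⟩
    cases τ with
    | zero => exact hQ
    | succ τ => exact hall τ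

theorem decides {S w : ℕ} (h : RunsTo p input Q A T ⟨0, fun _ => 0⟩)
    (hS : ∀ m, Q m → FitsInBits m S) (hw : ∀ m, Q m → ∀ r, Nat.size (m r) ≤ w) :
    Decides p input A T S w := by
  obtain ⟨h₁, h₂⟩ := h.exists_halt
  exact ⟨h₁, fun τ => hS _ (h₂ τ), fun τ => hw _ (h₂ τ)⟩

end RunsTo

/-! ### Explicit memory states -/

/-- A memory with sixteen work registers followed by an array `d`. -/
def layout (r₀ r₁ r₂ r₃ r₄ r₅ r₆ r₇ r₈ r₉ r₁₀ r₁₁ r₁₂ r₁₃ r₁₄ r₁₅ : ℕ) (d : ℕ → ℕ) : ℕ → ℕ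
  | 0 => r₀ | 1 => r₁ | 2 => r₂ | 3 => r₃ | 4 => r₄ | 5 => r₅ | 6 => r₆ | 7 => r₇
  | 8 => r₈ | 9 => r₉ | 10 => r₁₀ | 11 => r₁₁ | 12 => r₁₂ | 13 => r₁₃ | 14 => r₁₄ | 15 => r₁₅
  | i + 16 => d i

/-- The work registers are at most `V`; the array has `k` entries, all at most `ℓ`. -/
def Bounded (V k ℓ : ℕ) (m : ℕ → ℕ) : Prop :=
  (∀ a < 16, m a ≤ V) ∧ (∀ i, m (16 + i) ≤ ℓ) ∧ ∀ i, k ≤ i → m (16 + i) = 0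

section layout

variable {r₀ r₁ r₂ r₃ r₄ r₅ r₆ r₇ r₈ r₉ r₁₀ r₁₁ r₁₂ r₁₃ r₁₄ r₁₅ : ℕ} {d : ℕ → ℕ}

theorem layout_array (i : ℕ) :
    layout r₀ r₁ r₂ r₃ r₄ r₅ r₆ r₇ r₈ r₉ r₁₀ r₁₁ r₁₂ r₁₃ r₁₄ r₁₅ d (16 + i) = d i := by
  rw [Nat.add_comm]; rfl

theorem layout_work :
    let m := layout r₀ r₁ r₂ r₃ r₄ r₅ r₆ r₇ r₈ r₉ r₁₀ r₁₁ r₁₂ r₁₃ r₁₄ r₁₅ d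
    m 0 = r₀ ∧ m 1 = r₁ ∧ m 2 = r₂ ∧ m 3 = r₃ ∧ m 4 = r₄ ∧ m 5 = r₅ ∧
      m 6 = r₆ ∧ m 7 = r₇ ∧ m 8 = r₈ ∧ m 9 = r₉ ∧ m 10 = r₁₀ ∧ m 11 = r₁₁ ∧
      m 12 = r₁₂ ∧ m 13 = r₁₃ ∧ m 14 = r₁₄ ∧ m 15 = r₁₅ := by
  refine ⟨?_, ?_, ?_, ?_, ?_, ?_, ?_, ?_, ?_, ?_, ?_, ?_, ?_, ?_, ?_, ?_⟩ <;> rfl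

/-- Together with `update_layout_work`, this returns the memory to the explicit form `layout …`
after each write, so that `simp` can execute the program symbolically. -/
theorem update_layout_array (i x : ℕ) :
    Function.update (layout r₀ r₁ r₂ r₃ r₄ r₅ r₆ r₇ r₈ r₉ r₁₀ r₁₁ r₁₂ r₁₃ r₁₄ r₁₅ d) (16 + i) x =
      layout r₀ r₁ r₂ r₃ r₄ r₅ r₆ r₇ r₈ r₉ r₁₀ r₁₁ r₁₂ r₁₃ r₁₄ r₁₅ (Function.update d i x) := by
  funext a
  rw [Nat.add_comm]
  by_cases ha : a < 16
  · rw [Function.update_of_ne (by omega)]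
    interval_cases a <;> rfl
  · obtain ⟨b, rfl⟩ := Nat.exists_eq_add_of_le' (not_lt.mp ha)
    change _ = Function.update d i x b
    by_cases hb : b = i
    · subst hb; simp
    · rw [Function.update_of_ne (by omega), Function.update_of_ne hb]; rfl

theorem update_layout_work (r x : ℕ) (hr : r < 16) :
    Function.update (layout r₀ r₁ r₂ r₃ r₄ r₅ r₆ r₇ r₈ r₉ r₁₀ r₁₁ r₁₂ r₁₃ r₁₄ r₁₅ d) r x =
      layout (if r = 0 then x else r₀) (if r = 1 then x else r₁) (if r = 2 then x else r₂)
        (if r = 3 then x else r₃) (if r = 4 then x else r₄) (if r = 5 then x else r₅)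
        (if r = 6 then x else r₆) (if r = 7 then x else r₇) (if r = 8 then x else r₈)
        (if r = 9 then x else r₉) (if r = 10 then x else r₁₀) (if r = 11 then x else r₁₁)
        (if r = 12 then x else r₁₂) (if r = 13 then x else r₁₃) (if r = 14 then x else r₁₄)
        (if r = 15 then x else r₁₅) d := by
  funext a
  by_cases ha : a < 16
  · by_cases har : a = r
    · subst har
      rw [Function.update_self]
      interval_cases a <;> rfl
    · rw [Function.update_of_ne har]
      interval_cases a <;> simp [layout, Ne.symm har]
  · obtain ⟨b, rfl⟩ := Nat.exists_eq_add_of_le' (not_lt.mp ha)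
    rw [Function.update_of_ne (by omega)]; rfl

theorem bounded_layout {V k ℓ : ℕ} (h₀ : r₀ ≤ V) (h₁ : r₁ ≤ V) (h₂ : r₂ ≤ V) (h₃ : r₃ ≤ V)
    (h₄ : r₄ ≤ V) (h₅ : r₅ ≤ V) (h₆ : r₆ ≤ V) (h₇ : r₇ ≤ V) (h₈ : r₈ ≤ V) (h₉ : r₉ ≤ V)
    (h₁₀ : r₁₀ ≤ V) (h₁₁ : r₁₁ ≤ V) (h₁₂ : r₁₂ ≤ V) (h₁₃ : r₁₃ ≤ V) (h₁₄ : r₁₄ ≤ V)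
    (h₁₅ : r₁₅ ≤ V) (hd : ∀ i, d i ≤ ℓ) (hd' : ∀ i, k ≤ i → d i = 0) :
    Bounded V k ℓ (layout r₀ r₁ r₂ r₃ r₄ r₅ r₆ r₇ r₈ r₉ r₁₀ r₁₁ r₁₂ r₁₃ r₁₄ r₁₅ d) := by
  refine ⟨fun a ha => ?_, fun i => ?_, fun i hi => ?_⟩
  · interval_cases a <;> assumption
  · rw [layout_array]; exact hd i
  · rw [layout_array]; exact hd' i hi

end layout

end RAM

/-! ### The algorithm and its specification on the input words -/

namespace RAM

/-- Reachability along walks. Registers: `0 = n`, `1 = k`, `2 = s`, `3 = t`, `4 = 1`,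
`5` rounds left; `6, 7, 8, 9` position, walk, remaining vertices and vertex of the outer scan;
`10, 11, 12` position, walk and remaining vertices of the inner scan; `13, 14` scratch; `15 = 0`;
`16 + j` the number of final vertices of walk `j` that are known to be reachable. -/
def reachProgram : Program :=
  [.const 4 1, .read 0 15, .read 1 4, .const 6 2, .read 2 6, .const 6 3, .read 3 6,
   .jeq 2 3 49, .copy 5 0,
   -- next round
   .jeq 5 15 50, .sub 5 5 4, .const 6 4, .const 7 0,
   -- next walk of the outer scan
   .jeq 7 1 9, .read 8 6, .add 6 6 4,
   -- next vertex of the outer scan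
   .jeq 8 15 47, .read 9 6, .jeq 9 2 23, .const 13 16, .add 13 13 7, .load 14 13, .jlt 14 8 44,
   -- the vertex is reachable
   .jeq 9 3 49, .const 10 4, .const 11 0,
   -- next walk of the inner scan
   .jeq 11 1 44, .read 12 10, .add 10 10 4,
   -- next vertex of the inner scan
   .jeq 12 15 42, .read 14 10, .jeq 14 9 33, .jump 39,
   .const 13 16, .add 13 13 11, .load 14 13, .sub 14 14 12, .add 14 14 12, .store 13 14,
   .sub 12 12 4, .add 10 10 4, .jump 29,
   .add 11 11 4, .jump 26,
   .sub 8 8 4, .add 6 6 4, .jump 16,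
   .add 7 7 4, .jump 13,
   .halt true, .halt false]

/-- The input position at which walk `j` starts (with its length). -/
def offset (input : List ℕ) : ℕ → ℕ
  | 0 => 4
  | j + 1 => offset input j + 1 + input.getD (offset input j) 0

/-- The number of vertices of walk `j`. -/
def walkLength (input : List ℕ) (j : ℕ) : ℕ := input.getD (offset input j) 0

/-- The vertex of walk `j` at which `c` vertices remain, itself included. -/
def vertexAt (input : List ℕ) (j c : ℕ) : ℕ := input.getD (offset input (j + 1) - c) 0

/-- The input lists `k` walks, of at most `ℓ` vertices each, with vertices below `n`, along which
reachability (`R`) propagates, and `t`, if reachable, is reachable by fewer than `n` edges.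
Here `Lv m` stands for the vertices reachable from `s` by at most `m` edges. -/
structure ReachSpec (input : List ℕ) (n k s t ℓ : ℕ) (R : ℕ → Prop) (Lv : ℕ → ℕ → Prop) :
    Prop where
  getD_zero : input.getD 0 0 = n
  getD_one : input.getD 1 0 = k
  getD_two : input.getD 2 0 = s
  getD_three : input.getD 3 0 = t
  s_lt : s < n
  t_lt : t < n
  length_le : ∀ j < k, walkLength input j ≤ ℓ
  vertexAt_lt : ∀ j < k, ∀ c, 1 ≤ c → c ≤ walkLength input j → vertexAt input j c < n
  reach_s : R s
  reach_walk : ∀ j < k, ∀ c c', 1 ≤ c' → c' ≤ c → c ≤ walkLength input j →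
    R (vertexAt input j c) → R (vertexAt input j c')
  level_zero : ∀ v, Lv 0 v → v = s
  level_succ : ∀ m v, Lv (m + 1) v → Lv m v ∨ ∃ j < k, ∃ c, 1 ≤ c ∧ c + 1 ≤ walkLength input j ∧
    Lv m (vertexAt input j (c + 1)) ∧ vertexAt input j c = v
  level_complete : R t → Lv (n - 1) t

/-- Only vertices in `R` are marked by `d`. -/
structure Sound (input : List ℕ) (k : ℕ) (R : ℕ → Prop) (d : ℕ → ℕ) : Prop where
  eq_zero : ∀ j, k ≤ j → d j = 0
  le_length : ∀ j < k, d j ≤ walkLength input j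
  reach : ∀ j < k, ∀ c, 1 ≤ c → c ≤ d j → R (vertexAt input j c)

/-- All occurrences of `v` are marked by `d`. -/
def AllMarked (input : List ℕ) (k : ℕ) (d : ℕ → ℕ) (v : ℕ) : Prop :=
  ∀ j < k, ∀ c, 1 ≤ c → c ≤ walkLength input j → vertexAt input j c = v → c ≤ d j

/-- `v` is `s` or has a marked occurrence. -/
def Reached (input : List ℕ) (k s : ℕ) (d : ℕ → ℕ) (v : ℕ) : Prop :=
  v = s ∨ ∃ j < k, ∃ c, 1 ≤ c ∧ c ≤ d j ∧ vertexAt input j c = v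

/-- A bound on the contents of the work registers. -/
def registerBound (n k ℓ : ℕ) : ℕ := n + k * (ℓ + 1) + 17

/-! ### Correctness and running time of the loops -/

section

variable {input : List ℕ} {n k s t ℓ : ℕ} {R : ℕ → Prop} {Lv : ℕ → ℕ → Prop}

theorem offset_succ (input : List ℕ) (j : ℕ) :
    offset input (j + 1) = offset input j + 1 + walkLength input j := rfl

theorem ReachSpec.offset_le (H : ReachSpec input n k s t ℓ R Lv) {j : ℕ} (hj : j ≤ k) :
    offset input j ≤ j * (ℓ + 1) + 4 := by
  induction j with
  | zero => simp [offset]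
  | succ j ih =>
    have := H.length_le j hj
    have := ih (by omega)
    rw [offset_succ, add_mul]
    omega

theorem ReachSpec.offset_lt_bound (H : ReachSpec input n k s t ℓ R Lv) {j : ℕ} (hj : j ≤ k) :
    offset input j + 12 < registerBound n k ℓ := by
  have h₁ := H.offset_le hj
  have h₂ : j * (ℓ + 1) ≤ k * (ℓ + 1) := Nat.mul_le_mul_right _ hj
  have := H.s_lt
  rw [registerBound]
  omega

theorem le_registerBound (n ℓ : ℕ) (hk : 1 ≤ k) :
    n ≤ registerBound n k ℓ ∧ ℓ ≤ registerBound n k ℓ ∧ k + 17 ≤ registerBound n k ℓ := by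
  have h₁ : 1 * (ℓ + 1) ≤ k * (ℓ + 1) := Nat.mul_le_mul_right _ hk
  have h₂ : k * 1 ≤ k * (ℓ + 1) := Nat.mul_le_mul_left _ (by omega)
  rw [registerBound]
  omega

theorem Sound.le_of_spec (H : ReachSpec input n k s t ℓ R Lv) {d : ℕ → ℕ} (hd : Sound input k R d)
    (j : ℕ) : d j ≤ ℓ := by
  by_cases hj : j < k
  · exact (hd.le_length j hj).trans (H.length_le j hj)
  · simp [hd.eq_zero j (by omega)]

/-- With truncated subtraction `d j - c + c` is `max (d j) c`, which the program computes without a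
branch; marks therefore never shrink. -/
theorem le_update_mark (d : ℕ → ℕ) (j c : ℕ) : d ≤ Function.update d j (d j - c + c) := by
  intro i
  by_cases hi : i = j
  · subst hi; simp only [Function.update_self]; omega
  · simp [hi]

/-- The newly marked occurrences follow a reachable one on the same walk, so `reach_walk` applies to
them. -/
theorem Sound.mark {d : ℕ → ℕ} (hd : Sound input k R d)
    (H : ReachSpec input n k s t ℓ R Lv) {j c : ℕ} (hj : j < k) (hc : c ≤ walkLength input j) (hR : R (vertexAt input j c)) :
    Sound input k R (Function.update d j (d j - c + c)) where
  eq_zero i hi := by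
    rw [Function.update_of_ne (by omega)]; exact hd.eq_zero i hi
  le_length i hi := by
    have := hd.le_length i hi
    by_cases h : i = j
    · subst h; simp only [Function.update_self]; omega
    · simpa [h] using this
  reach i hi c' h1 hc' := by
    by_cases h : i = j
    · subst h
      simp only [Function.update_self] at hc'
      by_cases h' : c' ≤ c
      · exact H.reach_walk i hi c c' h1 h' hc hR
      · exact hd.reach i hi c' h1 (by omega)
    · simp only [ne_eq, h, not_false_eq_true, Function.update_of_ne] at hc'
      exact hd.reach i hi c' h1 hc'

theorem AllMarked.mono {d d' : ℕ → ℕ} (h : d ≤ d') {v : ℕ} (hv : AllMarked input k d v) :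
    AllMarked input k d' v :=
  fun j hj c h1 h2 h3 => (hv j hj c h1 h2 h3).trans (h j)

local notation "Runs" => RunsTo reachProgram input (Bounded (registerBound n k ℓ) k ℓ) (R t)

/-- Continuation form, as for the other loops: a time bound from every admissible exit state yields
one from the entry. Scratch registers are only bounded, while the array is known to be sound, to
have grown, and to mark the occurrences of `v` scanned. -/
theorem runs_mark_walk (H : ReachSpec input n k s t ℓ R Lv) {r x i c v j T : ℕ}
    (hj : j < k) (hr : r ≤ n) (hx : x ≤ registerBound n k ℓ) (hi : i ≤ k) (hc : c ≤ ℓ)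
    (hv : v ≤ n) (hRv : R v) (e : ℕ) : ∀ (y a b : ℕ) (d : ℕ → ℕ),
    y + e = offset input (j + 1) → e ≤ walkLength input j →
    a ≤ registerBound n k ℓ → b ≤ registerBound n k ℓ → Sound input k R d →
    (∀ (a' b' : ℕ) (d' : ℕ → ℕ), a' ≤ registerBound n k ℓ → b' ≤ registerBound n k ℓ →
      Sound input k R d' → d ≤ d' →
      (∀ c', 1 ≤ c' → c' ≤ e → vertexAt input j c' = v → c' ≤ d' j) →
      Runs T ⟨42, layout n k s t 1 r x i c v (offset input (j + 1)) j 0 a' b' 0 d'⟩) →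
    Runs (T + 13 * e + 1) ⟨29, layout n k s t 1 r x i c v y j e a b 0 d⟩ := by
  have hs := H.s_lt
  have ht := H.t_lt
  have hb := H.offset_lt_bound (j := j + 1) hj
  obtain ⟨hb1, hb2, hb3⟩ := le_registerBound n ℓ (show 1 ≤ k by omega)
  induction e with
  | zero =>
    intro y a b d hy he ha hb hd cont
    refine .jeq rfl ?_ (fun _ => ?_) (fun h => absurd rfl h)
    · apply bounded_layout <;> first | exact hd.le_of_spec H | exact hd.eq_zero | omega
    · obtain rfl : y = offset input (j + 1) := by omega
      exact cont a b d ha hb hd le_rfl (by omega)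
  | succ e ih =>
    intro y a b d hy he ha hb hd cont
    have hle := H.length_le j hj
    have hvy : input.getD y 0 = vertexAt input j (e + 1) := by
      rw [vertexAt]; congr 1; omega
    have hvn := H.vertexAt_lt j hj (e + 1) (by omega) he
    have hdj := hd.le_of_spec H j
    -- The end of the loop body, shared by the branch that marks and the branch that does not.
    have next : ∀ (a b : ℕ) (d₁ : ℕ → ℕ), a ≤ registerBound n k ℓ → b ≤ registerBound n k ℓ →
        Sound input k R d₁ → d ≤ d₁ → (vertexAt input j (e + 1) = v → e + 1 ≤ d₁ j) →
        Runs (T + 13 * e + 1 + 3) ⟨39, layout n k s t 1 r x i c v y j (e + 1) a b 0 d₁⟩ := by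
      intro a b d₁ ha hb hd₁ hdd₁ hmark
      refine .sub rfl ?_ (.add rfl ?_ (.jump rfl ?_ ?_))
      all_goals simp -failIfUnchanged only [update_layout_work, layout_work, Nat.reduceLT,
        Nat.reduceEqDiff, reduceIte, Nat.add_sub_cancel]
      on_goal 4 =>
        refine ih _ a b d₁ (by omega) (by omega) ha hb hd₁ fun a' b' d' ha' hb' hd' hdd' hm => ?_
        refine cont a' b' d' ha' hb' hd' (hdd₁.trans hdd') fun c' h1 h2 h3 => ?_
        rcases Nat.lt_or_eq_of_le h2 with h2 | rfl
        · exact hm c' h1 (by omega) h3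
        · exact (hmark h3).trans (hdd' j)
      all_goals
        apply bounded_layout <;> first | exact hd₁.le_of_spec H | exact hd₁.eq_zero | omega
    refine RunsTo.mono (T := T + 13 * e + 1 + 3 + 6 + 3) ?_ (by omega)
    refine .jeq rfl ?_ (fun h => absurd h (Nat.succ_ne_zero e)) fun _ =>
      .read rfl ?_ (.jeq rfl ?_ (fun h => .const rfl ?_ (.add rfl ?_ (.load rfl ?_
        (.sub rfl ?_ (.add rfl ?_ (.store rfl ?_ ?marked)))))) fun h => .jump rfl ?_ ?unmarked)
    all_goals simp -failIfUnchanged only [update_layout_work, update_layout_array, layout_array,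
      layout_work, Nat.reduceLT, Nat.reduceEqDiff, reduceIte, hvy, Nat.reduceAdd]
    case marked =>
      simp only [update_layout_work, layout_work, Nat.reduceLT, Nat.reduceEqDiff, reduceIte,
        hvy] at h
      exact next _ _ _ (by omega) (by omega) (hd.mark H hj he (by rwa [h]))
        (le_update_mark _ _ _) fun _ => by simp
    case unmarked =>
      simp only [update_layout_work, layout_work, Nat.reduceLT, Nat.reduceEqDiff, reduceIte,
        hvy] at h
      exact (next _ _ _ (by omega) (by omega) hd le_rfl (absurd · h)).mono (by omega)
    all_goals
      apply bounded_layout <;> first | exact hd.le_of_spec H | exact hd.eq_zero | omega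

/-- Walks scanned earlier keep their marks because the array only grows. -/
theorem runs_mark_all (H : ReachSpec input n k s t ℓ R Lv) {r x i c v T : ℕ} (hk : 1 ≤ k)
    (hr : r ≤ n) (hx : x ≤ registerBound n k ℓ) (hi : i ≤ k) (hc : c ≤ ℓ)
    (hv : v ≤ n) (hRv : R v) (m : ℕ) : ∀ (j e a b : ℕ) (d : ℕ → ℕ), j + m = k →
    e ≤ registerBound n k ℓ → a ≤ registerBound n k ℓ → b ≤ registerBound n k ℓ →
    Sound input k R d →
    (∀ (y' e' a' b' : ℕ) (d' : ℕ → ℕ), y' ≤ registerBound n k ℓ → e' ≤ registerBound n k ℓ →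
      a' ≤ registerBound n k ℓ → b' ≤ registerBound n k ℓ → Sound input k R d' → d ≤ d' →
      (∀ j' < k, j ≤ j' → ∀ c', 1 ≤ c' → c' ≤ walkLength input j' → vertexAt input j' c' = v →
        c' ≤ d' j') →
      Runs T ⟨44, layout n k s t 1 r x i c v y' k e' a' b' 0 d'⟩) →
    Runs (T + m * (13 * ℓ + 6) + 1)
      ⟨26, layout n k s t 1 r x i c v (offset input j) j e a b 0 d⟩ := by
  have hs := H.s_lt
  have ht := H.t_lt
  obtain ⟨hb1, hb2, hb3⟩ := le_registerBound n ℓ hk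
  induction m with
  | zero =>
    intro j e a b d hj he ha hb hd cont
    obtain rfl : j = k := by omega
    have hy := H.offset_lt_bound le_rfl
    refine .jeq rfl ?_ (fun _ => ?_) (fun h => absurd rfl h)
    · apply bounded_layout <;> first | exact hd.le_of_spec H | exact hd.eq_zero | omega
    · exact (cont (offset input j) e a b d (by omega) he ha hb hd le_rfl (by omega)).mono (by simp)
  | succ m ih =>
    intro j e a b d hj he ha hb hd cont
    have hjk : j < k := by omega
    have hle := H.length_le j hjk
    have hy := H.offset_lt_bound hjk.le
    have hy' := H.offset_lt_bound (j := j + 1) hjk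
    have hlen : input.getD (offset input j) 0 = walkLength input j := rfl
    refine RunsTo.mono (T := T + m * (13 * ℓ + 6) + 1 + 2 + 13 * walkLength input j + 1 + 3) ?_
      (by linarith)
    refine .jeq rfl ?_ (fun h => absurd (show j = k from h) hjk.ne) fun _ =>
      .read rfl ?_ (.add rfl ?_ ?scan)
    all_goals simp -failIfUnchanged only [update_layout_work, layout_work, Nat.reduceLT,
      Nat.reduceEqDiff, reduceIte, Nat.reduceAdd, hlen]
    case scan =>
      refine runs_mark_walk H hjk hr hx hi hc hv hRv _ _ a b d rfl le_rfl ha hb hd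
        fun a₁ b₁ d₁ ha₁ hb₁ hd₁ hdd₁ hmark => ?_
      refine .add rfl ?_ (.jump rfl ?_ ?loop)
      all_goals simp -failIfUnchanged only [update_layout_work, layout_work, Nat.reduceLT,
        Nat.reduceEqDiff, reduceIte]
      case loop =>
        refine ih (j + 1) 0 a₁ b₁ d₁ (by omega) (by omega) ha₁ hb₁ hd₁
          fun y' e' a' b' d' hy' he' ha' hb' hd' hdd' hm => ?_
        refine cont y' e' a' b' d' hy' he' ha' hb' hd' (hdd₁.trans hdd')
          fun j' hj' hjj' c' h1 h2 h3 => ?_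
        rcases Nat.lt_or_eq_of_le hjj' with hlt | rfl
        · exact hm j' hj' hlt c' h1 h2 h3
        · exact (hmark c' h1 h2 h3).trans (hdd' j)
      all_goals
        apply bounded_layout <;> first | exact hd₁.le_of_spec H | exact hd₁.eq_zero | omega
    all_goals
      apply bounded_layout <;> first | exact hd.le_of_spec H | exact hd.eq_zero | omega

/-- Every vertex found reachable in the walk suffix `c, …, 1` of walk `i` has been processed. -/
def Processed (input : List ℕ) (k s t : ℕ) (d d' : ℕ → ℕ) (i c : ℕ) : Prop :=
  ∀ c', 1 ≤ c' → c' ≤ c → vertexAt input i c' = s ∨ c' ≤ d i →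
    vertexAt input i c' ≠ t ∧ AllMarked input k d' (vertexAt input i c')

theorem Processed.mono {d₀ d d' d'' : ℕ → ℕ} {i c : ℕ} (h : Processed input k s t d d' i c)
    (hd : d₀ ≤ d) (hd' : d' ≤ d'') : Processed input k s t d₀ d'' i c :=
  fun c' h1 h2 h3 => (h c' h1 h2 (h3.imp_right fun h => h.trans (hd i))).imp_right (.mono hd')

/-- The array changes during the scan, and each occurrence is tested against its current state. As
marks only grow, everything marked at the start of the scan passes its test, which is all that
`Processed` records. -/
theorem runs_scan_walk (H : ReachSpec input n k s t ℓ R Lv) {r i T : ℕ} (hr : r ≤ n)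
    (hi : i < k) (c : ℕ) : ∀ (x v y j e a b : ℕ) (d : ℕ → ℕ),
    x + c = offset input (i + 1) → c ≤ walkLength input i → v ≤ n →
    y ≤ registerBound n k ℓ → j ≤ k → e ≤ registerBound n k ℓ → a ≤ registerBound n k ℓ →
    b ≤ registerBound n k ℓ → Sound input k R d →
    (∀ (v' y' j' e' a' b' : ℕ) (d' : ℕ → ℕ), v' ≤ n → y' ≤ registerBound n k ℓ → j' ≤ k →
      e' ≤ registerBound n k ℓ → a' ≤ registerBound n k ℓ → b' ≤ registerBound n k ℓ →
      Sound input k R d' → d ≤ d' → Processed input k s t d d' i c →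
      Runs T ⟨47, layout n k s t 1 r (offset input (i + 1)) i 0 v' y' j' e' a' b' 0 d'⟩) →
    Runs (T + c * (k * (13 * ℓ + 6) + 14) + 1)
      ⟨16, layout n k s t 1 r x i c v y j e a b 0 d⟩ := by
  have hs := H.s_lt
  have ht := H.t_lt
  obtain ⟨hb1, hb2, hb3⟩ := le_registerBound n ℓ (show 1 ≤ k by omega)
  have hx := H.offset_lt_bound (j := i + 1) hi
  have hle := H.length_le i hi
  induction c with
  | zero =>
    intro x v y j e a b d hxc hc hv hy hj he ha hb hd cont
    obtain rfl : x = offset input (i + 1) := by omega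
    refine .jeq rfl ?_ (fun _ => ?_) (fun h => absurd rfl h)
    · apply bounded_layout <;> first | exact hd.le_of_spec H | exact hd.eq_zero | omega
    · exact (cont v y j e a b d hv hy hj he ha hb hd le_rfl fun _ _ _ => by omega).mono (by simp)
  | succ c ih =>
    intro x v y j e a b d hxc hc hv hy hj he ha hb hd cont
    have hvx : input.getD x 0 = vertexAt input i (c + 1) := by
      rw [vertexAt]; congr 1; omega
    have hvn := H.vertexAt_lt i hi (c + 1) (by omega) hc
    have hdi := hd.le_of_spec H i
    have next : ∀ (y j e a b : ℕ) (d₁ : ℕ → ℕ), y ≤ registerBound n k ℓ → j ≤ k →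
        e ≤ registerBound n k ℓ → a ≤ registerBound n k ℓ → b ≤ registerBound n k ℓ →
        Sound input k R d₁ → d ≤ d₁ →
        (vertexAt input i (c + 1) = s ∨ c + 1 ≤ d i →
          vertexAt input i (c + 1) ≠ t ∧ AllMarked input k d₁ (vertexAt input i (c + 1))) →
        Runs (T + c * (k * (13 * ℓ + 6) + 14) + 1 + 3)
          ⟨44, layout n k s t 1 r x i (c + 1) (vertexAt input i (c + 1)) y j e a b 0 d₁⟩ := by
      intro y j e a b d₁ hy hj he ha hb hd₁ hdd₁ hmark
      refine .sub rfl ?_ (.add rfl ?_ (.jump rfl ?_ ?loop))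
      all_goals simp -failIfUnchanged only [update_layout_work, layout_work, Nat.reduceLT,
        Nat.reduceEqDiff, reduceIte, Nat.add_sub_cancel]
      case loop =>
        refine ih _ _ y j e a b d₁ (by omega) (by omega) hvn.le hy hj he ha hb hd₁
          fun v' y' j' e' a' b' d' hv' hy' hj' he' ha' hb' hd' hdd' hm => ?_
        refine cont v' y' j' e' a' b' d' hv' hy' hj' he' ha' hb' hd' (hdd₁.trans hdd')
          fun c' h1 h2 h3 => ?_
        rcases Nat.lt_or_eq_of_le h2 with h2 | rfl
        · exact hm.mono hdd₁ le_rfl c' h1 (by omega) h3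
        · exact (hmark h3).imp_right (.mono hdd')
      all_goals
        apply bounded_layout <;> first | exact hd₁.le_of_spec H | exact hd₁.eq_zero | omega
    -- Reached in two ways, because the vertex is `s` or because its occurrence is marked; only its
    -- reachability matters.
    have process : ∀ a b : ℕ, a ≤ registerBound n k ℓ → b ≤ registerBound n k ℓ →
        R (vertexAt input i (c + 1)) →
        Runs (T + c * (k * (13 * ℓ + 6) + 14) + 1 + 3 + k * (13 * ℓ + 6) + 1 + 3)
          ⟨23, layout n k s t 1 r x i (c + 1) (vertexAt input i (c + 1)) y j e a b 0 d⟩ := by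
      intro a b ha hb hR
      refine .jeq rfl ?_ (fun h => ?found) fun h => .const rfl ?_ (.const rfl ?_ ?mark)
      all_goals simp -failIfUnchanged only [update_layout_work, Nat.reduceLT, Nat.reduceEqDiff,
        reduceIte, Nat.reduceAdd]
      case found =>
        have hvt : vertexAt input i (c + 1) = t := h
        refine .halt true rfl (by simpa [← hvt] using hR) ?_
        apply bounded_layout <;> first | exact hd.le_of_spec H | exact hd.eq_zero | omega
      case mark =>
        exact runs_mark_all H (by omega) hr (by omega) hi.le (by omega) hvn.le hR k 0 e a b d
          (by omega) he ha hb hd fun y' e' a' b' d' hy' he' ha' hb' hd' hdd' hm =>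
            next y' k e' a' b' d' hy' le_rfl he' ha' hb' hd' hdd' fun _ =>
              ⟨h, fun j' hj' c' => hm j' hj' (Nat.zero_le _) c'⟩
      all_goals
        apply bounded_layout <;> first | exact hd.le_of_spec H | exact hd.eq_zero | omega
    refine RunsTo.mono
      (T := T + c * (k * (13 * ℓ + 6) + 14) + 1 + 3 + k * (13 * ℓ + 6) + 1 + 3 + 4 + 3) ?_
      (by linarith)
    refine .jeq rfl ?_ (fun h => absurd h (Nat.succ_ne_zero c)) fun _ => .read rfl ?_
      (.jeq rfl ?_ (fun h => ?start) fun h => .const rfl ?_ (.add rfl ?_ (.load rfl ?_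
        (.jlt rfl ?_ (fun h' => ?unmarked) fun h' => ?marked))))
    all_goals simp -failIfUnchanged only [update_layout_work, layout_array, layout_work,
      Nat.reduceLT, Nat.reduceEqDiff, reduceIte, Nat.reduceAdd, hvx]
    case start =>
      simp only [update_layout_work, layout_work, Nat.reduceLT, Nat.reduceEqDiff, reduceIte,
        hvx] at h
      exact (process a b ha hb (h ▸ H.reach_s)).mono (by omega)
    case unmarked =>
      simp only [update_layout_work, layout_array, layout_work, Nat.reduceLT, Nat.reduceEqDiff,
        reduceIte, hvx] at h h'
      exact (next y j e _ _ d hy hj he (by omega) (by omega) hd le_rfl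
        (by rintro (h1 | h1); exacts [absurd h1 h, by omega])).mono (by omega)
    case marked =>
      simp only [update_layout_work, layout_array, layout_work, Nat.reduceLT, Nat.reduceEqDiff,
        reduceIte, hvx, not_lt] at h'
      exact process _ _ (by omega) (by omega) (hd.reach i hi _ (by omega) h')
    all_goals
      apply bounded_layout <;> first | exact hd.le_of_spec H | exact hd.eq_zero | omega

theorem runs_scan_all (H : ReachSpec input n k s t ℓ R Lv) {r T : ℕ} (hk : 1 ≤ k) (hr : r ≤ n)
    (m : ℕ) : ∀ (i c v y j e a b : ℕ) (d : ℕ → ℕ), i + m = k → c ≤ ℓ → v ≤ n →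
    y ≤ registerBound n k ℓ → j ≤ k → e ≤ registerBound n k ℓ → a ≤ registerBound n k ℓ →
    b ≤ registerBound n k ℓ → Sound input k R d →
    (∀ (x' c' v' y' j' e' a' b' : ℕ) (d' : ℕ → ℕ), x' ≤ registerBound n k ℓ → c' ≤ ℓ →
      v' ≤ n → y' ≤ registerBound n k ℓ → j' ≤ k → e' ≤ registerBound n k ℓ →
      a' ≤ registerBound n k ℓ → b' ≤ registerBound n k ℓ → Sound input k R d' → d ≤ d' →
      (∀ i' < k, i ≤ i' → Processed input k s t d d' i' (walkLength input i')) →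
      Runs T ⟨9, layout n k s t 1 r x' k c' v' y' j' e' a' b' 0 d'⟩) →
    Runs (T + m * (ℓ * (k * (13 * ℓ + 6) + 14) + 6) + 1)
      ⟨13, layout n k s t 1 r (offset input i) i c v y j e a b 0 d⟩ := by
  have hs := H.s_lt
  have ht := H.t_lt
  obtain ⟨hb1, hb2, hb3⟩ := le_registerBound n ℓ hk
  induction m with
  | zero =>
    intro i c v y j e a b d hi hc hv hy hj he ha hb hd cont
    obtain rfl : i = k := by omega
    have hx := H.offset_lt_bound le_rfl
    refine .jeq rfl ?_ (fun _ => ?_) (fun h => absurd rfl h)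
    · apply bounded_layout <;> first | exact hd.le_of_spec H | exact hd.eq_zero | omega
    · exact (cont (offset input i) c v y j e a b d (by omega) hc hv hy hj he ha hb hd le_rfl
        (by omega)).mono (by simp)
  | succ m ih =>
    intro i c v y j e a b d hi hc hv hy hj he ha hb hd cont
    have hik : i < k := by omega
    have hle := H.length_le i hik
    have hx := H.offset_lt_bound hik.le
    have hx' := H.offset_lt_bound (j := i + 1) hik
    have hlen : input.getD (offset input i) 0 = walkLength input i := rfl
    refine RunsTo.mono (T := T + m * (ℓ * (k * (13 * ℓ + 6) + 14) + 6) + 1 + 2 +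
      walkLength input i * (k * (13 * ℓ + 6) + 14) + 1 + 3) ?_ ?_
    swap
    · have := Nat.mul_le_mul_right (k * (13 * ℓ + 6) + 14) hle
      linarith
    refine .jeq rfl ?_ (fun h => absurd (show i = k from h) hik.ne) fun _ =>
      .read rfl ?_ (.add rfl ?_ ?scan)
    all_goals simp -failIfUnchanged only [update_layout_work, layout_work, Nat.reduceLT,
      Nat.reduceEqDiff, reduceIte, Nat.reduceAdd, hlen]
    case scan =>
      refine runs_scan_walk H hr hik _ _ v y j e a b d rfl le_rfl hv hy hj he ha hb hd
        fun v₁ y₁ j₁ e₁ a₁ b₁ d₁ hv₁ hy₁ hj₁ he₁ ha₁ hb₁ hd₁ hdd₁ hproc => ?_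
      refine .add rfl ?_ (.jump rfl ?_ ?loop)
      all_goals simp -failIfUnchanged only [update_layout_work, layout_work, Nat.reduceLT,
        Nat.reduceEqDiff, reduceIte]
      case loop =>
        refine ih (i + 1) 0 v₁ y₁ j₁ e₁ a₁ b₁ d₁ (by omega) (by omega) hv₁ hy₁ hj₁ he₁ ha₁ hb₁
          hd₁ fun x' c' v' y' j' e' a' b' d' hx' hc' hv' hy' hj' he' ha' hb' hd' hdd' hm => ?_
        refine cont x' c' v' y' j' e' a' b' d' hx' hc' hv' hy' hj' he' ha' hb' hd'
          (hdd₁.trans hdd') fun i' hi' hii' => ?_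
        rcases Nat.lt_or_eq_of_le hii' with hlt | rfl
        · exact (hm i' hi' hlt).mono hdd₁ le_rfl
        · exact hproc.mono le_rfl hdd'
      all_goals
        apply bounded_layout <;> first | exact hd₁.le_of_spec H | exact hd₁.eq_zero | omega
    all_goals
      apply bounded_layout <;> first | exact hd.le_of_spec H | exact hd.eq_zero | omega

/-- For an arc at places `c + 1`, `c` of walk `j`, the tail is `s` or has a marked occurrence,
possibly on another walk. Processing it forces `c + 1 ≤ d' j`, so the head at `c` is marked too. -/
theorem reached_succ (H : ReachSpec input n k s t ℓ R Lv) {d d' : ℕ → ℕ} {m : ℕ}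
    (hd : Sound input k R d) (hdd' : d ≤ d')
    (hproc : ∀ i < k, Processed input k s t d d' i (walkLength input i))
    (hm : ∀ v, Lv m v → Reached input k s d v) (v : ℕ) (hv : Lv (m + 1) v) :
    Reached input k s d' v := by
  rcases H.level_succ m v hv with hv | ⟨j, hj, c, hc, hc', hu, rfl⟩
  · exact (hm v hv).imp_right fun ⟨j, hj, c, h1, h2, h3⟩ => ⟨j, hj, c, h1, h2.trans (hdd' j), h3⟩
  · have hall : AllMarked input k d' (vertexAt input j (c + 1)) := by
      rcases hm _ hu with h | ⟨i, hi, e, h1, h2, h3⟩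
      · exact (hproc j hj _ (by omega) hc' (.inl h)).2
      · exact h3 ▸ (hproc i hi e h1 (h2.trans (hd.le_length i hi)) (.inr h2)).2
    have := hall j hj (c + 1) (by omega) hc' rfl
    exact .inr ⟨j, hj, c, hc, by omega, rfl⟩

/-- A completed round has met no reached occurrence of `t`. The case `s = t` is tested separately,
since an isolated `s` lies on no walk. -/
theorem not_level_of_processed (hst : s ≠ t) {d d' : ℕ → ℕ} {m : ℕ}
    (hd : Sound input k R d)
    (hproc : ∀ i < k, Processed input k s t d d' i (walkLength input i))
    (hm : ∀ v, Lv m v → Reached input k s d v) : ¬ Lv m t := by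
  intro ht
  rcases hm t ht with h | ⟨i, hi, e, h1, h2, h3⟩
  · exact hst h.symm
  · exact (hproc i hi e h1 (h2.trans (hd.le_length i hi)) (.inr h2)).1 h3

/-- Invariant after `m` rounds, with `r` left: level `m` is reached, and `t` lies in no earlier
level. -/
theorem runs_rounds (H : ReachSpec input n k s t ℓ R Lv) (hk : 1 ≤ k) (hst : s ≠ t) (r : ℕ) :
    ∀ (m x i c v y j e a b : ℕ) (d : ℕ → ℕ), m + r = n → x ≤ registerBound n k ℓ → i ≤ k →
    c ≤ ℓ → v ≤ n → y ≤ registerBound n k ℓ → j ≤ k → e ≤ registerBound n k ℓ →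
    a ≤ registerBound n k ℓ → b ≤ registerBound n k ℓ → Sound input k R d →
    (∀ v, Lv m v → Reached input k s d v) → (∀ m' < m, ¬ Lv m' t) →
    Runs (r * (k * (ℓ * (k * (13 * ℓ + 6) + 14) + 6) + 5) + 1)
      ⟨9, layout n k s t 1 r x i c v y j e a b 0 d⟩ := by
  have hs := H.s_lt
  have ht := H.t_lt
  obtain ⟨hb1, hb2, hb3⟩ := le_registerBound n ℓ hk
  induction r with
  | zero =>
    intro m x i c v y j e a b d hm hx hi hc hv hy hj he ha hb hd hlv hlt
    -- Here `m = n`, so level `n - 1` has already been tested for `t`.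
    have hRt : ¬ R t := fun h => hlt (n - 1) (by omega) (H.level_complete h)
    have hQ : Bounded (registerBound n k ℓ) k ℓ
        (layout n k s t 1 0 x i c v y j e a b 0 d) := by
      apply bounded_layout <;> first | exact hd.le_of_spec H | exact hd.eq_zero | omega
    exact .jeq rfl hQ (fun _ => .halt false rfl (by simpa using hRt) hQ) (fun h => absurd rfl h)
  | succ r ih =>
    intro m x i c v y j e a b d hm hx hi hc hv hy hj he ha hb hd hlv hlt
    refine RunsTo.mono (T := r * (k * (ℓ * (k * (13 * ℓ + 6) + 14) + 6) + 5) + 1 +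
      k * (ℓ * (k * (13 * ℓ + 6) + 14) + 6) + 1 + 4) ?_ (by linarith)
    refine .jeq rfl ?_ (fun h => absurd h (Nat.succ_ne_zero r)) fun _ => .sub rfl ?_
      (.const rfl ?_ (.const rfl ?_ ?scan))
    all_goals simp -failIfUnchanged only [update_layout_work, layout_work, Nat.reduceLT,
      Nat.reduceEqDiff, reduceIte, Nat.reduceAdd, Nat.add_sub_cancel]
    case scan =>
      refine runs_scan_all H hk (by omega) k 0 c v y j e a b d (by omega) hc hv hy hj he ha hb hd
        fun x' c' v' y' j' e' a' b' d' hx' hc' hv' hy' hj' he' ha' hb' hd' hdd' hp => ?_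
      have hproc := fun i hi => hp i hi (Nat.zero_le _)
      refine ih (m + 1) x' k c' v' y' j' e' a' b' d' (by omega) hx' le_rfl hc' hv' hy' hj' he'
        ha' hb' hd' (reached_succ H hd hdd' hproc hlv) fun m' hm' => ?_
      rcases Nat.lt_or_eq_of_le (Nat.le_of_lt_succ hm') with h | rfl
      · exact hlt m' h
      · exact not_level_of_processed hst hd hproc hlv
    all_goals
      apply bounded_layout <;> first | exact hd.le_of_spec H | exact hd.eq_zero | omega

theorem runs_reachProgram (H : ReachSpec input n k s t ℓ R Lv) (hk : 1 ≤ k) :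
    Runs (n * (k * (ℓ * (k * (13 * ℓ + 6) + 14) + 6) + 5) + 10) ⟨0, fun _ => 0⟩ := by
  have hs := H.s_lt
  have ht := H.t_lt
  have h0 := H.getD_zero
  have h1 := H.getD_one
  have h2 := H.getD_two
  have h3 := H.getD_three
  obtain ⟨hb1, hb2, hb3⟩ := le_registerBound n ℓ hk
  have hd : Sound input k R fun _ => 0 :=
    ⟨fun _ _ => rfl, fun _ _ => Nat.zero_le _, fun _ _ c hc hc' => by omega⟩
  have hmem : (fun _ => 0 : ℕ → ℕ) = layout 0 0 0 0 0 0 0 0 0 0 0 0 0 0 0 0 fun _ => 0 := by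
    funext a
    by_cases ha : a < 16
    · interval_cases a <;> rfl
    · obtain ⟨b, rfl⟩ := Nat.exists_eq_add_of_le' (not_lt.mp ha)
      rfl
  rw [hmem]
  refine .const rfl ?_ (.read rfl ?_ (.read rfl ?_ (.const rfl ?_ (.read rfl ?_ (.const rfl ?_
    (.read rfl ?_ (.jeq rfl ?_ (fun h => ?found) fun h => .copy rfl ?_ ?rounds)))))))
  all_goals simp -failIfUnchanged only [update_layout_work, layout_work, Nat.reduceLT,
    Nat.reduceEqDiff, reduceIte, Nat.reduceAdd, h0, h1, h2, h3]
  case found =>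
    simp only [update_layout_work, layout_work, Nat.reduceLT, Nat.reduceEqDiff, reduceIte,
      h0, h1, h2, h3] at h
    refine .halt true rfl (by simpa [← h] using H.reach_s) ?_
    apply bounded_layout <;> first | exact hd.le_of_spec H | exact hd.eq_zero | omega
  case rounds =>
    simp only [update_layout_work, layout_work, Nat.reduceLT, Nat.reduceEqDiff, reduceIte,
      h0, h1, h2, h3] at h
    exact runs_rounds H hk h n 0 _ _ _ _ _ _ _ _ _ _ (by omega) (by omega) (by omega) (by omega)
      (by omega) (by omega) (by omega) (by omega) (by omega) (by omega) hd
      (fun v hv => .inl (H.level_zero v hv)) (by omega)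
  all_goals
    apply bounded_layout <;> first | exact hd.le_of_spec H | exact hd.eq_zero | omega

end

end RAM

namespace RAM

/-! ### The input -/

section Encoding

variable {hdr : List ℕ} {ls : List (List ℕ)}

theorem getD_append_cons (a b : List ℕ) (x : ℕ) : (a ++ x :: b).getD a.length 0 = x := by
  simp

theorem encoding_split (hdr : List ℕ) {j : ℕ} (hj : j < ls.length) :
    hdr ++ (ls.map fun l => l.length :: l).flatten =
      (hdr ++ ((ls.take j).map fun l => l.length :: l).flatten) ++
        ls[j].length :: (ls[j] ++ ((ls.drop (j + 1)).map fun l => l.length :: l).flatten) := by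
  conv_lhs => rw [← List.take_append_drop j ls, List.drop_eq_getElem_cons hj,
    List.map_append, List.map_cons, List.flatten_append, List.flatten_cons]
  simp only [List.append_assoc, List.cons_append]

theorem offset_encoding (h : hdr.length = 4) {j : ℕ} (hj : j ≤ ls.length) :
    offset (hdr ++ (ls.map fun l => l.length :: l).flatten) j =
      (hdr ++ ((ls.take j).map fun l => l.length :: l).flatten).length := by
  induction j with
  | zero => simp [offset, h]
  | succ j ih =>
    rw [offset, ih (by omega), encoding_split hdr hj, getD_append_cons,
      ← List.take_concat_get' ls j hj, List.map_append, List.flatten_append]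
    simp only [List.length_append, List.map_cons, List.map_nil, List.flatten_cons,
      List.flatten_nil, List.length_cons, List.length_nil]
    omega

theorem walkLength_encoding (h : hdr.length = 4) {j : ℕ} (hj : j < ls.length) :
    walkLength (hdr ++ (ls.map fun l => l.length :: l).flatten) j = ls[j].length := by
  rw [walkLength, offset_encoding h hj.le, encoding_split hdr hj, getD_append_cons]

theorem vertexAt_encoding (h : hdr.length = 4) {j : ℕ} (hj : j < ls.length) {c : ℕ}
    (hc : 1 ≤ c) (hc' : c ≤ ls[j].length) :
    vertexAt (hdr ++ (ls.map fun l => l.length :: l).flatten) j c =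
      ls[j][ls[j].length - c]'(by omega) := by
  rw [vertexAt, offset_succ, walkLength_encoding h hj, offset_encoding h hj.le,
    encoding_split hdr hj, Nat.add_sub_assoc hc', Nat.add_assoc,
    List.getD_append_right _ _ _ _ (by omega), Nat.add_sub_cancel_left, Nat.add_comm 1,
    List.getD_cons_succ, List.getD_append _ _ _ _ (by omega), List.getD_eq_getElem]

end Encoding

theorem encodeInstance_eq {n k : ℕ} (P : Fin k → List (Fin n)) (s t : Fin n) :
    encodeInstance P s t = [n, k, (s : ℕ), (t : ℕ)] ++
      ((List.ofFn fun i => (P i).map Fin.val).map fun l => l.length :: l).flatten := by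
  simp [encodeInstance, List.map_ofFn, Function.comp_def]

theorem walkLength_encodeInstance {n k : ℕ} (P : Fin k → List (Fin n)) (s t : Fin n) {j : ℕ}
    (hj : j < k) : walkLength (encodeInstance P s t) j = (P ⟨j, hj⟩).length := by
  rw [encodeInstance_eq, walkLength_encoding rfl (by simpa using hj)]
  simp

theorem vertexAt_encodeInstance {n k : ℕ} (P : Fin k → List (Fin n)) (s t : Fin n) {j : ℕ}
    (hj : j < k) {c : ℕ} (hc : 1 ≤ c) (hc' : c ≤ (P ⟨j, hj⟩).length) :
    vertexAt (encodeInstance P s t) j c =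
      ((P ⟨j, hj⟩)[(P ⟨j, hj⟩).length - c]'(by omega) : ℕ) := by
  rw [encodeInstance_eq, vertexAt_encoding rfl (by simpa using hj) hc (by simpa using hc')]
  simp

/-! ### Reachability -/

theorem reflTransGen_getElem_of_isChain {α : Type*} {r : α → α → Prop} {l : List α}
    (h : l.IsChain r) {a b : ℕ} (hab : a ≤ b) (hb : b < l.length) :
    Relation.ReflTransGen r (l[a]'(by omega)) l[b] := by
  induction b, hab using Nat.le_induction with
  | base => exact .refl
  | succ b hab ih => exact (ih (by omega)).tail (List.isChain_iff_getElem.mp h b hb)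

/-- The vertices reachable from `s` by at most `m` arcs. -/
def level {n : ℕ} (G : Digraph (Fin n)) (s : Fin n) : ℕ → Set (Fin n)
  | 0 => {s}
  | m + 1 => level G s m ∪ {v | ∃ u ∈ level G s m, G.Adj u v}

theorem subset_level_of_level_succ_eq {n : ℕ} {G : Digraph (Fin n)} {s : Fin n} {m : ℕ}
    (h : level G s (m + 1) = level G s m) {v : Fin n} (hv : DiReachable G s v) :
    v ∈ level G s m := by
  induction hv with
  | refl =>
    clear h
    induction m with
    | zero => rfl
    | succ m ih => exact .inl ih
  | tail _ huv ih => rw [← h]; exact .inr ⟨_, ih, huv⟩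

/-- If two consecutive levels agree, the level already contains everything reachable; so the levels
grow strictly as long as they miss `t`. -/
theorem lt_ncard_level {n : ℕ} {G : Digraph (Fin n)} {s t : Fin n} (ht : DiReachable G s t)
    (m : ℕ) (hm : t ∉ level G s m) : m + 1 ≤ (level G s m).ncard := by
  induction m with
  | zero => simp [level]
  | succ m ih =>
    have hm' : t ∉ level G s m := fun h => hm (.inl h)
    have hss : level G s m ⊂ level G s (m + 1) :=
      (Set.subset_union_left).ssubset_of_ne fun h =>
        hm' (subset_level_of_level_succ_eq h.symm ht)
    have := Set.ncard_lt_ncard hss (Set.toFinite _)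
    have := ih hm'
    omega

theorem mem_level_of_diReachable {n : ℕ} {G : Digraph (Fin n)} {s t : Fin n}
    (ht : DiReachable G s t) : t ∈ level G s (n - 1) := by
  by_contra hm
  have h := lt_ncard_level ht _ hm
  have h' : (level G s (n - 1)).ncard < n := by
    have hss : level G s (n - 1) ⊂ Set.univ := Set.ssubset_univ_iff.mpr fun h => hm (h ▸ trivial)
    simpa using Set.ncard_lt_ncard hss (Set.toFinite _)
  omega

theorem reachSpec_encodeInstance {n k ℓ : ℕ} {G : Digraph (Fin n)} {P : Fin k → List (Fin n)}
    (hP : IsWalkDecomposition G P) (hℓ : ∀ i, (P i).length ≤ ℓ) (s t : Fin n) :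
    ReachSpec (encodeInstance P s t) n k s t ℓ (fun v => ∃ h : v < n, DiReachable G s ⟨v, h⟩)
      (fun m v => ∃ h : v < n, ⟨v, h⟩ ∈ level G s m) where
  getD_zero := rfl
  getD_one := rfl
  getD_two := rfl
  getD_three := rfl
  s_lt := s.2
  t_lt := t.2
  length_le j hj := by rw [walkLength_encodeInstance P s t hj]; exact hℓ _
  vertexAt_lt j hj c hc hc' := by
    rw [walkLength_encodeInstance P s t hj] at hc'
    rw [vertexAt_encodeInstance P s t hj hc hc']
    exact Fin.is_lt _
  reach_s := ⟨s.2, .refl⟩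
  reach_walk j hj c c' h1 h2 h3 h4 := by
    rw [walkLength_encodeInstance P s t hj] at h3
    rw [vertexAt_encodeInstance P s t hj (h1.trans h2) h3] at h4
    rw [vertexAt_encodeInstance P s t hj h1 (h2.trans h3)]
    exact ⟨Fin.is_lt _, h4.2.trans
      (reflTransGen_getElem_of_isChain (hP.walk _).2 (by omega) (by omega))⟩
  level_zero v := by
    rintro ⟨h, hv⟩
    exact congrArg Fin.val (show (⟨v, h⟩ : Fin n) = s from hv)
  level_succ m v := by
    rintro ⟨h, hv | ⟨u, hu, huv⟩⟩
    · exact .inl ⟨h, hv⟩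
    · obtain ⟨⟨j, hj⟩, p, q, hpq⟩ := hP.cover _ _ huv
      have hlen : (P ⟨j, hj⟩).length = p.length + 2 + q.length := by
        simp [← hpq]; omega
      -- Places are counted from the end: with walk `p ++ [u, v] ++ q`, the vertex `v` and its
      -- successors number `q.length + 1`.
      refine .inr ⟨j, hj, q.length + 1, by omega, ?_, ?_, ?_⟩
      · rw [walkLength_encodeInstance P s t hj]; omega
      · rw [vertexAt_encodeInstance P s t hj (by omega) (by omega)]
        have : (P ⟨j, hj⟩)[(P ⟨j, hj⟩).length - (q.length + 1 + 1)]'(by omega) = u := by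
          simp only [show (P ⟨j, hj⟩).length - (q.length + 1 + 1) = p.length by omega]
          simp [← hpq]
        exact ⟨Fin.is_lt _, by simpa [this] using hu⟩
      · rw [vertexAt_encodeInstance P s t hj (by omega) (by omega)]
        simp only [show (P ⟨j, hj⟩).length - (q.length + 1) = p.length + 1 by omega]
        simp [← hpq]
  level_complete := fun ⟨h, ht⟩ => ⟨h, mem_level_of_diReachable ht⟩

/-! ### Resource bounds -/

theorem Decides.mono {p : Program} {input : List ℕ} {A : Prop} {T T' S S' w w' : ℕ}
    (h : Decides p input A T S w) (hT : T ≤ T') (hS : S ≤ S') (hw : w ≤ w') :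
    Decides p input A T' S' w' := by
  obtain ⟨⟨b, ⟨τ, hτ, hp⟩, hb⟩, h₂, h₃⟩ := h
  exact ⟨⟨b, ⟨τ, hτ.trans hT, hp⟩, hb⟩, fun τ => (h₂ τ).imp fun _ h => ⟨h.1, h.2.trans hS⟩,
    fun τ r => (h₃ τ r).trans hw⟩

/-- Work registers hold input positions, array entries only numbers up to `ℓ`. Charging both alike
would cost an extra `k * log k`. -/
theorem Bounded.fitsInBits {V k ℓ S B D : ℕ} {m : ℕ → ℕ} (h : Bounded V k ℓ m) (hB : 1 ≤ B)
    (hD : 1 ≤ D) (hV : Nat.size V ≤ B) (hℓ : Nat.size ℓ ≤ D) (hS : 16 * B + k * D ≤ S) :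
    FitsInBits m S := by
  obtain ⟨h₁, h₂, h₃⟩ := h
  refine ⟨16 + k, fun a ha => ?_, ?_⟩
  · obtain ⟨b, rfl⟩ := Nat.exists_eq_add_of_le (show 16 ≤ a by omega)
    exact h₃ b (by omega)
  · rw [Finset.sum_range_add]
    refine le_trans (Nat.add_le_add (Finset.sum_le_card_nsmul _ _ B fun a ha => ?_)
      (Finset.sum_le_card_nsmul _ _ D fun a _ => ?_)) (by simpa using hS)
    · exact max_le hB ((Nat.size_le_size (h₁ a (Finset.mem_range.mp ha))).trans hV)
    · exact max_le hD ((Nat.size_le_size (h₂ a)).trans hℓ)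

theorem Bounded.size_le {V k ℓ w : ℕ} {m : ℕ → ℕ} (h : Bounded V k ℓ m) (hℓ : ℓ ≤ V)
    (hV : Nat.size V ≤ w) (r : ℕ) : Nat.size (m r) ≤ w := by
  refine (Nat.size_le_size ?_).trans hV
  by_cases hr : r < 16
  · exact h.1 r hr
  · obtain ⟨b, rfl⟩ := Nat.exists_eq_add_of_le (not_lt.mp hr)
    exact (h.2.1 b).trans hℓ

theorem size_registerBound_le_log {n k ℓ : ℕ} (hn : 1 ≤ n) (hk : 1 ≤ k) :
    Nat.size (registerBound n k ℓ) ≤ 9 * Nat.log 2 (n + k + ℓ) := by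
  rw [Nat.size_le, registerBound]
  have hlt := Nat.lt_pow_succ_log_self (b := 2) (by norm_num) (n + k + ℓ)
  have hL : 1 ≤ Nat.log 2 (n + k + ℓ) := Nat.log_pos (by norm_num) (by omega)
  set L := Nat.log 2 (n + k + ℓ)
  have h1 : k * (ℓ + 1) ≤ 2 ^ (L + 1) * 2 ^ (L + 1) := Nat.mul_le_mul (by omega) (by omega)
  rw [← pow_add] at h1
  have h2 : 2 ^ (L + 1) ≤ 2 ^ (7 * L) := Nat.pow_le_pow_right (by norm_num) (by omega)
  have h3 : 2 ^ (L + 1 + (L + 1)) ≤ 2 ^ (7 * L) := Nat.pow_le_pow_right (by norm_num) (by omega)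
  have h4 : 2 ^ 7 ≤ 2 ^ (7 * L) := Nat.pow_le_pow_right (by norm_num) (by omega)
  have h5 : 2 ^ (7 * L + 2) ≤ 2 ^ (9 * L) := Nat.pow_le_pow_right (by norm_num) (by omega)
  rw [pow_add] at h5
  omega

/-- Walks may repeat, so `k` need not be polynomial in `n + ℓ`. The crude bound `k ≤ 2 ^ k`
suffices, as the space bound has a factor `k` anyway. -/
theorem size_registerBound_le_mul_log {n k ℓ : ℕ} (hn : 1 ≤ n) (hk : 1 ≤ k) (hℓ : 1 ≤ ℓ) :
    Nat.size (registerBound n k ℓ) ≤ 9 * (k * Nat.log 2 (n + ℓ)) := by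
  rw [Nat.size_le, registerBound]
  have hlt := Nat.lt_pow_succ_log_self (b := 2) (by norm_num) (n + ℓ)
  have hL : 1 ≤ Nat.log 2 (n + ℓ) := Nat.log_pos (by norm_num) (by omega)
  set L := Nat.log 2 (n + ℓ)
  have hkL : k ≤ k * L := Nat.le_mul_of_pos_right k hL
  have hLk : L ≤ k * L := Nat.le_mul_of_pos_left L hk
  set K := k * L
  have h1 : k * (ℓ + 1) ≤ 2 ^ k * 2 ^ (L + 1) := Nat.mul_le_mul Nat.lt_two_pow_self.le (by omega)
  rw [← pow_add] at h1
  have h2 : 2 ^ (L + 1) ≤ 2 ^ (7 * K) := Nat.pow_le_pow_right (by norm_num) (by omega)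
  have h3 : 2 ^ (k + (L + 1)) ≤ 2 ^ (7 * K) := Nat.pow_le_pow_right (by norm_num) (by omega)
  have h4 : 2 ^ 7 ≤ 2 ^ (7 * K) := Nat.pow_le_pow_right (by norm_num) (by omega)
  have h5 : 2 ^ (7 * K + 2) ≤ 2 ^ (9 * K) := Nat.pow_le_pow_right (by norm_num) (by omega)
  rw [pow_add] at h5
  omega

theorem steps_le {n k ℓ : ℕ} (hn : 1 ≤ n) (hk : 1 ≤ k) (hℓ : 1 ≤ ℓ) :
    n * (k * (ℓ * (k * (13 * ℓ + 6) + 14) + 6) + 5) + 10 ≤ 54 * (n * ℓ ^ 2 * k ^ 2) := by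
  have h1 : k * (13 * ℓ + 6) + 14 ≤ 33 * (k * ℓ) := by
    have := Nat.mul_le_mul_left k hℓ
    have := Nat.mul_le_mul hk hℓ
    linarith
  have h2 : ℓ * (k * (13 * ℓ + 6) + 14) + 6 ≤ 39 * (ℓ * (k * ℓ)) := by
    have := Nat.mul_le_mul_left ℓ h1
    have := Nat.mul_le_mul hℓ (Nat.mul_le_mul hk hℓ)
    linarith
  have h3 : k * (ℓ * (k * (13 * ℓ + 6) + 14) + 6) + 5 ≤ 44 * (k * (ℓ * (k * ℓ))) := by
    have := Nat.mul_le_mul_left k h2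
    have := Nat.mul_le_mul hk (Nat.mul_le_mul hℓ (Nat.mul_le_mul hk hℓ))
    linarith
  have h4 := Nat.mul_le_mul_left n h3
  have h5 := Nat.mul_le_mul hn (Nat.mul_le_mul hk (Nat.mul_le_mul hℓ (Nat.mul_le_mul hk hℓ)))
  linarith

theorem decides_of_isWalkDecomposition {n k ℓ : ℕ} {G : Digraph (Fin n)}
    {P : Fin k → List (Fin n)} (s t : Fin n) (hk : 1 ≤ k) (hP : IsWalkDecomposition G P)
    (hℓ : ∀ i, (P i).length ≤ ℓ) :
    Decides reachProgram (encodeInstance P s t) (DiReachable G s t)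
      (54 * (n * ℓ ^ 2 * k ^ 2)) (146 * (k * Nat.log 2 (n + ℓ)))
      (9 * Nat.log 2 (n + k + ℓ)) := by
  have hn : 1 ≤ n := s.pos
  have hℓ' : 1 ≤ ℓ := (List.length_pos_iff.mpr (hP.walk ⟨0, hk⟩).1).trans_le (hℓ _)
  have hL : 1 ≤ Nat.log 2 (n + ℓ) := Nat.log_pos (by norm_num) (by omega)
  have hkL := Nat.mul_le_mul hk hL
  have hrun := (runs_reachProgram (reachSpec_encodeInstance hP hℓ s t) hk).mono
    (steps_le hn hk hℓ')
  have hA : (∃ h : (t : ℕ) < n, DiReachable G s ⟨t, h⟩) = DiReachable G s t := by simp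
  rw [hA] at hrun
  refine hrun.decides (fun m hm => ?_) fun m hm r => ?_
  -- The space constant is `146 = 16 * 9 + 2`.
  · refine hm.fitsInBits (B := 9 * (k * Nat.log 2 (n + ℓ))) (D := 2 * Nat.log 2 (n + ℓ))
      (by omega) (by omega) (size_registerBound_le_mul_log hn hk hℓ') ?_ (by linarith)
    rw [Nat.size_le]
    have := Nat.lt_pow_succ_log_self (b := 2) (by norm_num) (n + ℓ)
    have : 2 ^ (Nat.log 2 (n + ℓ) + 1) ≤ 2 ^ (2 * Nat.log 2 (n + ℓ)) :=
      Nat.pow_le_pow_right (by norm_num) (by omega)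
    omega
  · exact hm.size_le (le_registerBound n ℓ hk).2.1 (size_registerBound_le_log hn hk) r

end RAM

/-! ### Path decompositions and the final bounds -/

theorem IsPathDecomposition.isWalkDecomposition {n k : ℕ} {G : Digraph (Fin n)}
    {P : Fin k → List (Fin n)} (hP : IsPathDecomposition G P) : IsWalkDecomposition G P :=
  ⟨hP.walk, fun u v h => (hP.partition u v h).exists⟩

/-- The first arcs of the paths are distinct, since each arc lies on only one path. -/
theorem IsPathDecomposition.card_le {n k : ℕ} {G : Digraph (Fin n)}
    {P : Fin k → List (Fin n)} (hP : IsPathDecomposition G P) : k ≤ n * n := by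
  have h : ∀ i, ∃ e : Fin n × Fin n, LiesOn e.1 e.2 (P i) := by
    intro i
    match hl : P i, hP.has_edge i with
    | u :: v :: l, _ => exact ⟨(u, v), [], l, rfl⟩
  choose e he using h
  have hinj : Function.Injective e := by
    intro i j hij
    have hadj : G.Adj (e i).1 (e i).2 := by
      simpa using (hP.walk i).2.infix (he i)
    exact (hP.partition _ _ hadj).unique (he i) (hij ▸ he j)
  simpa using Fintype.card_le_of_injective e hinj

theorem theorem1 :
    ∃ (p : RAM.Program) (C : ℕ),
      (∀ (n k : ℕ) (G : Digraph (Fin n)) (P : Fin k → List (Fin n)) (s t : Fin n),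
        1 ≤ k → IsPathDecomposition G P →
          RAM.Decides p (encodeInstance P s t) (DiReachable G s t)
            (C * (n ^ 3 * k ^ 2)) (C * (k * Nat.log 2 n)) (C * Nat.log 2 n)) ∧
      (∀ (n k ℓ : ℕ) (G : Digraph (Fin n)) (P : Fin k → List (Fin n)) (s t : Fin n),
        1 ≤ k → IsWalkDecomposition G P → (∀ i, (P i).length ≤ ℓ) →
          RAM.Decides p (encodeInstance P s t) (DiReachable G s t)
            (C * (n * ℓ ^ 2 * k ^ 2)) (C * (k * Nat.log 2 (n + ℓ)))
            (C * Nat.log 2 (n + k + ℓ))) := by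
  -- `292 = 2 * 146`: for paths `ℓ = n`, and the logarithm of `n + n` is at most twice that of `n`.
  refine ⟨RAM.reachProgram, 292, fun n k G P s t hk hP => ?_, fun n k ℓ G P s t hk hP hℓ => ?_⟩
  · have hlen : ∀ i, (P i).length ≤ n := fun i => by simpa using (hP.simple i).length_le_card
    have hn : 2 ≤ n := (hP.has_edge ⟨0, hk⟩).trans (hlen _)
    have hL : 1 ≤ Nat.log 2 n := Nat.log_pos (by norm_num) hn
    refine (RAM.decides_of_isWalkDecomposition s t hk hP.isWalkDecomposition hlen).mono ?_ ?_ ?_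
    · rw [show n * n ^ 2 * k ^ 2 = n ^ 3 * k ^ 2 by ring]
      exact Nat.mul_le_mul_right _ (by norm_num)
    · have hlog : Nat.log 2 (n + n) ≤ 2 * Nat.log 2 n := by
        rw [← mul_two, Nat.log_mul_base (by norm_num) (by omega)]
        omega
      have := Nat.mul_le_mul_left k hlog
      linarith
    -- With `k ≤ n * n` and `2 ≤ n`, the argument is at most `2 * (n * n)`, hence at most `2 ^ (4 *
    -- L + 1)`.
    · have hlog : Nat.log 2 (n + k + n) ≤ 5 * Nat.log 2 n := by
        have hlt := Nat.lt_pow_succ_log_self (b := 2) (by norm_num) n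
        have hkn := hP.card_le
        refine Nat.lt_succ_iff.mp (Nat.log_lt_of_lt_pow (by omega) ?_)
        set L := Nat.log 2 n
        have h1 : n * n ≤ 2 ^ (L + 1) * 2 ^ (L + 1) := Nat.mul_le_mul hlt.le hlt.le
        have h2 : 2 ^ (L + 1) * 2 ^ (L + 1) ≤ 2 ^ (4 * L) := by
          rw [← pow_add]; exact Nat.pow_le_pow_right (by norm_num) (by omega)
        have h3 : 2 * n ≤ n * n := Nat.mul_le_mul_right n hn
        have h4 : 2 ^ (4 * L) * 2 ≤ 2 ^ (5 * L) := by
          rw [← pow_succ]; exact Nat.pow_le_pow_right (by norm_num) (by omega)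
        have h5 : 2 ^ (5 * L) < 2 ^ (5 * L + 1) := Nat.pow_lt_pow_right (by norm_num) (by omega)
        omega
      omega
  · exact (RAM.decides_of_isWalkDecomposition s t hk hP hℓ).mono
      (Nat.mul_le_mul_right _ (by norm_num)) (Nat.mul_le_mul_right _ (by norm_num))
      (Nat.mul_le_mul_right _ (by norm_num))
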